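/- **Setting.** Let $\Theta=[\underline\theta,\bar\theta]$ with $\underline\theta<\bar\theta$ and $\bar\theta>0$, let $\delta\in(0,1)$, and let $F$ be an absolutely continuous distribution on $\Theta$ with $\underline\theta<\delta\,\mathbb{E}_F[\theta]$. For a distribution $G$ on $\Theta$ with distribution function $G(\cdot)$, put $c_G(x)=\int_x^{\bar\theta}(1-G(m))\,dm$, let $u(G)$ be the unique solution of $u=\int_\Theta\max\{m,\delta u\}\,dG(m)$, and put $r(G)=\delta u(G)$. For a distribution $H$ on $\Theta$, let $\mathcal G(H)$ be the set of mean-preserving contractions of $H$: the distributions $G$ on $\Theta$ with $\int_x^{\bar\theta}G(m)\,dm\ge\int_x^{\bar\theta}H(m)\,dm$ for all $x\in\Theta$, with equality at $x=\underline\theta$. Put $\bar u=u(F)$, the socially efficient surplus, and $\bar r=r(F)$. In each period a good of quality $\theta\sim F$ is drawn, and a realization $z\in Z$ of a public signal $\xi:\Theta\to\Delta(Z)$ is observed by the agent and the principal. Let $F_z^\xi$ be the interim belief about $\theta$ given $z$ (a version of the conditional law of $\theta$ given $z$), assumed to be atomless for every $z$. Let $G_z^\varnothing$ be the point mass at $\mathbb{E}_{F_z^\xi}[\theta]$,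 let $G^\xi$ be the distribution of $\mathbb{E}_{F_z^\xi}[\theta]$ when $z$ is drawn from its unconditional law, and put $r^\xi=r(G^\xi)$. Below, $\mathbb{E}_\xi$ and "almost all $z$" refer to the unconditional law of $z$. A *stationary equilibrium* consists of continuation values $(U,V)\in\mathbb{R}^2$ of the agent and the principal and contracts $\langle p_z,G_z\rangle\in\mathbb{R}_+\times\mathcal G(F_z^\xi)$, $z\in Z$, such that 1. for every $z$, $\langle p_z,G_z\rangle$ maximizes $\hat p+\hat G(\delta U)\,\delta V$ over all $\langle\hat p,\hat G\rangle\in\mathbb{R}_+\times\mathcal G(F_z^\xi)$ that the agent accepts, i.e. that satisfy $c_{\hat G}(\delta U)-c_{G_z^\varnothing}(\delta U)\ge\hat p$ (the agent stops searching if and only if his posterior mean exceeds $\delta U$); 2. $U=\mathbb{E}_\xi[\delta U+c_{G_z}(\delta U)-p_z]$ and $V=\mathbb{E}_\xi[p_z+G_z(\delta U)\,\delta V]$, where both integrands are integrable. The principal *extracts the socially efficient surplus* in a stationary equilibrium if her value there is the whole efficient surplus net of the agent's autarky payoff, that is, $V=\bar u-u(G^\xi)$. **Corollary.** Suppose that $F_z^\xi$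 has full support on $\Theta$ for almost all $z\in Z$. Then there is a stationary equilibrium in which the principal extracts the socially efficient surplus if and only if $$\mathbb{E}_{F_z^\xi}[\theta\mid\theta\le\bar r]\le r^\xi\quad\text{for almost all }z\in Z.$$ The same condition is also necessary and sufficient for the following: a stationary equilibrium exists, and in every stationary equilibrium the principal extracts the socially efficient surplus. -/

import Mathlib

open Set MeasureTheory ProbabilityTheory
open scoped NNReal ENNReal

namespace PersuadedSearch

noncomputable section

/-- The incremental benefit `c_G(x) = ∫_x^θ̄ (1 - G(m)) dm` of a draw from the distribution `G`
(a measure carried by `[θlo, θhi]`) over an outside option `x`. -/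
def incrementalBenefit (θhi : ℝ) (G : Measure ℝ) (x : ℝ) : ℝ :=
  ∫ m in x..θhi, (1 - cdf G m)

/-- `𝒢(H)`: the distributions on `[θlo, θhi]` that are mean-preserving contractions of `H`. -/
def contractions (θlo θhi : ℝ) (H : Measure ℝ) : Set (Measure ℝ) :=
  {G | IsProbabilityMeasure G ∧ G (Icc θlo θhi)ᶜ = 0 ∧
    (∀ x ∈ Icc θlo θhi, ∫ m in x..θhi, cdf H m ≤ ∫ m in x..θhi, cdf G m) ∧
    ∫ m in θlo..θhi, cdf G m = ∫ m in θlo..θhi, cdf H m}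

/-- The posterior-mean distribution of an uninformative signal under the belief `H`: the point
mass at the mean of `H`. -/
def uninformative (H : Measure ℝ) : Measure ℝ :=
  Measure.dirac (∫ θ, θ ∂H)

/-- `u` solves the search problem with free observation of draws from `G`:
`u = ∫ max {m, δ u} dG(m)`. -/
def IsSearchValue (δ : ℝ) (G : Measure ℝ) (u : ℝ) : Prop :=
  u = ∫ m, max m (δ * u) ∂G

/-- The search problem has exactly one value. -/
theorem existsUnique_isSearchValue {δ : ℝ} (hδ0 : 0 < δ) (hδ1 : δ < 1) (G : Measure ℝ)
    [IsProbabilityMeasure G] (hG : Integrable (fun m : ℝ => m) G) :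
    ∃! u, IsSearchValue δ G u := by
  have hint : ∀ u : ℝ, Integrable (fun m : ℝ => max m (δ * u)) G := fun u =>
    hG.sup (integrable_const (δ * u))
  have hlip : LipschitzWith ⟨δ, hδ0.le⟩ (fun u : ℝ => ∫ m, max m (δ * u) ∂G) := by
    refine LipschitzWith.of_dist_le_mul fun u v => ?_
    rw [Real.dist_eq, Real.dist_eq, ← integral_sub (hint u) (hint v), ← Real.norm_eq_abs]
    refine (norm_integral_le_of_norm_le_const (C := δ * |u - v|)
      (Filter.Eventually.of_forall fun m => ?_)).trans ?_
    · rw [Real.norm_eq_abs, max_comm m, max_comm m]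
      refine (abs_max_sub_max_le_abs _ _ _).trans ?_
      rw [← mul_sub, abs_mul, abs_of_pos hδ0]
    · rw [probReal_univ, mul_one]
      exact le_rfl
  have hc : ContractingWith ⟨δ, hδ0.le⟩ (fun u : ℝ => ∫ m, max m (δ * u) ∂G) :=
    ⟨by exact_mod_cast hδ1, hlip⟩
  refine ⟨hc.fixedPoint, hc.fixedPoint_isFixedPt.symm, fun v hv => ?_⟩
  exact hc.fixedPoint_unique (show Function.IsFixedPt _ v from Eq.symm hv)

/-- The value `u(G)` of the search problem in which draws from `G` are observed for free. -/
def searchValue (δ : ℝ) (G : Measure ℝ) : ℝ :=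
  Classical.epsilon (IsSearchValue δ G)

theorem searchValue_spec {δ : ℝ} (hδ0 : 0 < δ) (hδ1 : δ < 1) (G : Measure ℝ)
    [IsProbabilityMeasure G] (hG : Integrable (fun m : ℝ => m) G) :
    IsSearchValue δ G (searchValue δ G) :=
  Classical.epsilon_spec (existsUnique_isSearchValue hδ0 hδ1 G hG).exists

/-- The reservation value `r(G) = δ u(G)`. -/
def reservationValue (δ : ℝ) (G : Measure ℝ) : ℝ :=
  δ * searchValue δ G

section PublicSignal

variable {Z : Type*} [MeasurableSpace Z]

/-- The law of the realization `z` of the public signal `ξ` when the quality has law `F`. -/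
def signalLaw (F : Measure ℝ) (ξ : Kernel ℝ Z) : Measure Z :=
  F.bind ξ

/-- `B` is a system of interim beliefs on `[θlo, θhi]` for the prior `F` and the public signal `ξ`:
`B z` is a probability measure on `[θlo, θhi]` for every `z`, and `B` is a version of the
conditional law of the quality given the realization (Bayes' rule). -/
structure IsInterimBelief (θlo θhi : ℝ) (F : Measure ℝ) (ξ : Kernel ℝ Z) (B : Kernel Z ℝ) :
    Prop where
  isMarkovKernel : IsMarkovKernel B
  carried : ∀ z, B z (Icc θlo θhi)ᶜ = 0
  bayes : (signalLaw F ξ).compProd B = (F.compProd ξ).map Prod.swap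

/-- `G^ξ`: the distribution of the posterior mean of an agent who observes only the public
signal. -/
def publicMeanLaw (F : Measure ℝ) (ξ : Kernel ℝ Z) (B : Kernel Z ℝ) : Measure ℝ :=
  (signalLaw F ξ).map (fun z => ∫ θ, θ ∂(B z))

/-- An agent with interim belief `H` and continuation value `U` accepts the contract `⟨p, G⟩`. -/
def Accepts (θhi δ U : ℝ) (H : Measure ℝ) (p : ℝ) (G : Measure ℝ) : Prop :=
  p ≤ incrementalBenefit θhi G (δ * U) - incrementalBenefit θhi (uninformative H) (δ * U)

/-- The principal's profit from an accepted contract `⟨p, G⟩`. The agent stops exactly at the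
posterior means `m > δ U`, so that search continues with probability `G(δ U)`. -/
def profit (δ U V p : ℝ) (G : Measure ℝ) : ℝ :=
  p + cdf G (δ * U) * (δ * V)

/-- Stationary equilibrium with a public signal: continuation values `(U, V)` of the agent and the
principal and a family of contracts `⟨p z, G z⟩`, one for each realization `z`. -/
structure IsStationaryEquilibrium (θlo θhi δ : ℝ) (F : Measure ℝ) (ξ : Kernel ℝ Z)
    (B : Kernel Z ℝ) (U V : ℝ) (p : Z → ℝ) (G : Z → Measure ℝ) : Prop where
  price_nonneg : ∀ z, 0 ≤ p z
  mem_contractions : ∀ z, G z ∈ contractions θlo θhi (B z)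
  accepts : ∀ z, Accepts θhi δ U (B z) (p z) (G z)
  profit_max : ∀ z, ∀ p' : ℝ, 0 ≤ p' → ∀ G' ∈ contractions θlo θhi (B z),
    Accepts θhi δ U (B z) p' G' → profit δ U V p' G' ≤ profit δ U V (p z) (G z)
  integrable_agent :
    Integrable (fun z => δ * U + incrementalBenefit θhi (G z) (δ * U) - p z) (signalLaw F ξ)
  self_generating_agent :
    U = ∫ z, (δ * U + incrementalBenefit θhi (G z) (δ * U) - p z) ∂(signalLaw F ξ)
  integrable_principal : Integrable (fun z => profit δ U V (p z) (G z)) (signalLaw F ξ)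
  self_generating_principal : V = ∫ z, profit δ U V (p z) (G z) ∂(signalLaw F ξ)

end PublicSignal

/-- The principal extracts the socially efficient surplus: her value `V` is the whole of the
efficient surplus `u(F)` net of the agent's autarky payoff, where `Gξ` is the distribution of
posterior means under autarky. -/
def ExtractsEfficientSurplus (δ : ℝ) (F Gξ : Measure ℝ) (V : ℝ) : Prop :=
  V = searchValue δ F - searchValue δ Gξ

end

end PersuadedSearch

/-!
The agent's participation constraint always binds, since the principal could otherwise raise the
price (`IsStationaryEquilibrium.price_eq`). Hence in every equilibrium the agent obtains his autarky
payoff `u(G^ξ)` and uses the cutoff `r = δ U = r^ξ` (`agent_value_eq`), and, with `w = δ V ≥ 0`, the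
principal solves for each realization the persuasion problem of maximizing
`E_G[(m - r)⁺ + w 1{m ≤ r}]` over the mean-preserving contractions `G` of the interim belief `H`
(`persuasionValue`).

This payoff lies below the convex function `w + (m - r - w)⁺`, so its value is at most
`w + c_H(r + w)`. Averaging over realizations yields `U + V ≤ δ (U + V) + c_F(δ (U + V))`, whence
`U + V ≤ u(F)`, with equality exactly if the bound is attained for almost every realization
(`total_value_le`, `total_value_eq_iff`).

The bound is attained if and only if `E_H[(θ - r) 1{θ ≤ r + w}] ≤ 0` (`exists_optimal_contraction`).
In that case the qualities up to `r + w` can be pooled at a mean that the agent rejects, all others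
being revealed. Otherwise, the optimum pools the qualities up to a cutoff `t < r + w` for which the
pooled mean is exactly `r`, and loses surplus on `(t, r + w]`. Optimality is verified by a convex
function with one kink, at `t`, that dominates the payoff; if `t = r`, then `H` has no mass below
`r`, and the agent should be fully informed (`persuasionValue_le_cutoffValue`).

At the efficient cutoff `r + w = δ u(F)`, which exceeds the lower end of the support, the condition
says that the truncated mean is at most `r^ξ` (`truncated_mean_le_iff`). It is therefore necessary
for extraction, and sufficient for an equilibrium with extraction to exist. Since
`E_H[(θ - r) 1{θ ≤ t}]` increases in `t ≥ r` and every equilibrium has `r + w ≤ δ u(F)`, the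
condition also makes the bound attained in every equilibrium.
-/

namespace PersuadedSearch

/-! ### Expected excess over a threshold -/

theorem ae_mem_Icc {a b : ℝ} {G : Measure ℝ} (hG : G (Icc a b)ᶜ = 0) : ∀ᵐ m ∂G, m ∈ Icc a b :=
  measure_eq_zero_iff_ae_notMem.1 hG |>.mono fun _ hm => not_not.1 hm

theorem integrable_id_of_carried {a b : ℝ} {G : Measure ℝ} [IsFiniteMeasure G]
    (hG : G (Icc a b)ᶜ = 0) : Integrable (fun m : ℝ => m) G :=
  Integrable.of_bound measurable_id.aestronglyMeasurable (max |a| |b|)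
    ((ae_mem_Icc hG).mono fun _ hm => abs_le_max_abs_abs hm.1 hm.2)

/-- The expected excess `E_G[(m - x)⁺]` of `m ∼ G` over the threshold `x`; for `G` carried by
`[θlo, θhi]` it is the incremental benefit `c_G(x)`. -/
noncomputable def expectedExcess (G : Measure ℝ) (x : ℝ) : ℝ :=
  ∫ m, max (m - x) 0 ∂G

theorem integrable_excess {G : Measure ℝ} [IsFiniteMeasure G]
    (hG : Integrable (fun m : ℝ => m) G) (x : ℝ) : Integrable (fun m => max (m - x) 0) G :=
  (hG.sub (integrable_const x)).sup (integrable_const 0)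

theorem integrable_sub_const {G : Measure ℝ} [IsFiniteMeasure G]
    (hG : Integrable (fun m : ℝ => m) G) (x : ℝ) : Integrable (fun m => m - x) G :=
  hG.sub (integrable_const x)

theorem expectedExcess_nonneg (G : Measure ℝ) (x : ℝ) : 0 ≤ expectedExcess G x :=
  integral_nonneg fun _ => le_max_right _ _

theorem integral_sub_const {G : Measure ℝ} [IsProbabilityMeasure G]
    (hG : Integrable (fun m : ℝ => m) G) (x : ℝ) : ∫ m, (m - x) ∂G = (∫ m, m ∂G) - x := by
  rw [integral_sub hG (integrable_const x)]
  simp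

theorem mean_sub_le_expectedExcess {G : Measure ℝ} [IsProbabilityMeasure G]
    (hG : Integrable (fun m : ℝ => m) G) (x : ℝ) : (∫ m, m ∂G) - x ≤ expectedExcess G x := by
  rw [← integral_sub_const hG]
  exact integral_mono (hG.sub (integrable_const x)) (integrable_excess hG x)
    fun _ => le_max_left _ _

/-- The autarky gain from a draw is at most the gain of an informed agent (Jensen). -/
theorem max_mean_sub_le_expectedExcess {G : Measure ℝ} [IsProbabilityMeasure G]
    (hG : Integrable (fun m : ℝ => m) G) (x : ℝ) :
    max ((∫ m, m ∂G) - x) 0 ≤ expectedExcess G x :=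
  max_le (mean_sub_le_expectedExcess hG x) (expectedExcess_nonneg G x)

theorem expectedExcess_of_le {a b : ℝ} {G : Measure ℝ} [IsProbabilityMeasure G]
    (hG : G (Icc a b)ᶜ = 0) {x : ℝ} (hx : x ≤ a) : expectedExcess G x = (∫ m, m ∂G) - x := by
  rw [← integral_sub_const (integrable_id_of_carried hG)]
  refine integral_congr_ae ((ae_mem_Icc hG).mono fun m hm => ?_)
  exact max_eq_left (by linarith [hm.1])

theorem expectedExcess_of_ge {a b : ℝ} {G : Measure ℝ} (hG : G (Icc a b)ᶜ = 0) {x : ℝ}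
    (hx : b ≤ x) : expectedExcess G x = 0 := by
  rw [expectedExcess, integral_eq_zero_of_ae]
  refine (ae_mem_Icc hG).mono fun m hm => ?_
  exact max_eq_right (by linarith [hm.2])

theorem cdf_eq_one_of_carried {a b : ℝ} {G : Measure ℝ} [IsProbabilityMeasure G]
    (hG : G (Icc a b)ᶜ = 0) {x : ℝ} (hx : b ≤ x) : cdf G x = 1 := by
  rw [cdf_eq_real, measureReal_def, (prob_compl_eq_zero_iff measurableSet_Iic).1,
    ENNReal.toReal_one]
  exact measure_mono_null (compl_subset_compl.2 fun m hm => hm.2.trans hx) hG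

/-- The layer-cake formula identifies the incremental benefit with the expected excess. -/
theorem incrementalBenefit_eq {a b : ℝ} {G : Measure ℝ} [IsProbabilityMeasure G]
    (hG : G (Icc a b)ᶜ = 0) (x : ℝ) : incrementalBenefit b G x = expectedExcess G x := by
  rcases le_total b x with hx | hx
  · rw [expectedExcess_of_ge hG hx, incrementalBenefit]
    refine intervalIntegral.integral_zero_ae (Filter.Eventually.of_forall fun m hm => ?_)
    rw [uIoc_of_ge hx] at hm
    rw [cdf_eq_one_of_carried hG hm.1.le, sub_self]
  have hid := integrable_id_of_carried hG
  have hlayer : ∀ t : ℝ, 0 < t → G.real {m | t < max (m - x) 0} = 1 - cdf G (x + t) := by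
    intro t ht
    rw [cdf_eq_real, ← probReal_compl_eq_one_sub measurableSet_Iic]
    congr 1
    ext m
    simp only [mem_ofPred_eq, lt_max_iff, mem_compl_iff, mem_Iic, not_le]
    constructor
    · rintro (h | h) <;> linarith
    · intro h
      left
      linarith
  rw [expectedExcess, (integrable_excess hid x).integral_eq_integral_meas_lt
    (Filter.Eventually.of_forall fun _ => le_max_right _ _),
    setIntegral_congr_fun measurableSet_Ioi hlayer, incrementalBenefit]
  have hsub : ∫ t in Ioi (0 : ℝ), (1 - cdf G (x + t)) =
      ∫ t in Ioc 0 (b - x), (1 - cdf G (x + t)) := by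
    refine setIntegral_eq_of_subset_of_forall_sdiff_eq_zero measurableSet_Ioi
      Ioc_subset_Ioi_self fun t ht => ?_
    have : b - x < t := by
      by_contra h
      exact ht.2 ⟨ht.1, not_lt.1 h⟩
    rw [cdf_eq_one_of_carried hG (by linarith), sub_self]
  rw [hsub, ← intervalIntegral.integral_of_le (by linarith),
    intervalIntegral.integral_comp_add_left (fun m => 1 - cdf G m)]
  simp

theorem integral_cdf_eq {a b : ℝ} {G : Measure ℝ} [IsProbabilityMeasure G]
    (hG : G (Icc a b)ᶜ = 0) (x : ℝ) : ∫ m in x..b, cdf G m = b - x - expectedExcess G x := by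
  have hint : IntervalIntegrable (fun m => cdf G m) volume x b :=
    (monotone_cdf G).intervalIntegrable
  rw [← incrementalBenefit_eq hG, incrementalBenefit,
    intervalIntegral.integral_sub intervalIntegrable_const hint]
  simp

/-- Mean-preserving contractions in terms of expected excesses: the convex order. -/
theorem mem_contractions_iff {a b : ℝ} {H : Measure ℝ} [IsProbabilityMeasure H]
    (hH : H (Icc a b)ᶜ = 0) {G : Measure ℝ} :
    G ∈ contractions a b H ↔ IsProbabilityMeasure G ∧ G (Icc a b)ᶜ = 0 ∧
      (∀ x, expectedExcess G x ≤ expectedExcess H x) ∧ ∫ m, m ∂G = ∫ m, m ∂H := by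
  constructor
  · rintro ⟨hp, hG, hle, heq⟩
    rw [integral_cdf_eq hG, integral_cdf_eq hH, expectedExcess_of_le hG le_rfl,
      expectedExcess_of_le hH le_rfl] at heq
    have hmean : ∫ m, m ∂G = ∫ m, m ∂H := by linarith
    refine ⟨hp, hG, fun x => ?_, hmean⟩
    rcases le_total x a with hx | hx
    · rw [expectedExcess_of_le hG hx, expectedExcess_of_le hH hx, hmean]
    rcases le_total b x with hx' | hx'
    · rw [expectedExcess_of_ge hG hx', expectedExcess_of_ge hH hx']
    have := hle x ⟨hx, hx'⟩
    rw [integral_cdf_eq hG, integral_cdf_eq hH] at this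
    linarith
  · rintro ⟨hp, hG, hle, hmean⟩
    refine ⟨hp, hG, fun x _ => ?_, ?_⟩
    · rw [integral_cdf_eq hG, integral_cdf_eq hH]
      linarith [hle x]
    · rw [integral_cdf_eq hG, integral_cdf_eq hH, expectedExcess_of_le hG le_rfl,
        expectedExcess_of_le hH le_rfl, hmean]

theorem mean_mem_Icc {a b : ℝ} {G : Measure ℝ} [IsProbabilityMeasure G]
    (hG : G (Icc a b)ᶜ = 0) : ∫ m, m ∂G ∈ Icc a b := by
  have hid := integrable_id_of_carried hG
  constructor
  · calc a = ∫ _, a ∂G := by simp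
      _ ≤ _ := integral_mono_ae (integrable_const a) hid ((ae_mem_Icc hG).mono fun _ h => h.1)
  · calc ∫ m, m ∂G ≤ ∫ _, b ∂G :=
        integral_mono_ae hid (integrable_const b) ((ae_mem_Icc hG).mono fun _ h => h.2)
      _ = b := by simp

theorem incrementalBenefit_uninformative {a b : ℝ} {H : Measure ℝ} [IsProbabilityMeasure H]
    (hH : H (Icc a b)ᶜ = 0) (x : ℝ) :
    incrementalBenefit b (uninformative H) x = max ((∫ θ, θ ∂H) - x) 0 := by
  have hcar : uninformative H (Icc a b)ᶜ = 0 := by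
    rw [uninformative, Measure.dirac_apply' _ measurableSet_Icc.compl]
    simpa using mean_mem_Icc hH
  have : IsProbabilityMeasure (uninformative H) := by
    unfold uninformative; infer_instance
  rw [incrementalBenefit_eq hcar, expectedExcess, uninformative, integral_dirac]

/-! ### The search value -/

theorem integral_max_eq {G : Measure ℝ} [IsProbabilityMeasure G]
    (hG : Integrable (fun m : ℝ => m) G) (x : ℝ) :
    ∫ m, max m x ∂G = x + expectedExcess G x := by
  have : ∀ m : ℝ, max m x = x + max (m - x) 0 := fun m => by
    rw [← max_add_add_left]; simp
  simp_rw [this]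
  rw [integral_add (integrable_const x) (integrable_excess hG x), expectedExcess]
  simp

theorem isSearchValue_iff {δ : ℝ} {G : Measure ℝ} [IsProbabilityMeasure G]
    (hG : Integrable (fun m : ℝ => m) G) {u : ℝ} :
    IsSearchValue δ G u ↔ u = δ * u + expectedExcess G (δ * u) := by
  rw [IsSearchValue, integral_max_eq hG]

theorem IsSearchValue.eq_searchValue {δ : ℝ} (hδ0 : 0 < δ) (hδ1 : δ < 1) {G : Measure ℝ}
    [IsProbabilityMeasure G] (hG : Integrable (fun m : ℝ => m) G) {u : ℝ}
    (hu : IsSearchValue δ G u) : u = searchValue δ G :=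
  (existsUnique_isSearchValue hδ0 hδ1 G hG).unique hu (searchValue_spec hδ0 hδ1 G hG)

theorem expectedExcess_sub_le {G : Measure ℝ} [IsProbabilityMeasure G]
    (hG : Integrable (fun m : ℝ => m) G) {x y : ℝ} (hxy : x ≤ y) :
    expectedExcess G y ≤ expectedExcess G x := by
  refine integral_mono (integrable_excess hG y) (integrable_excess hG x) fun m => ?_
  exact max_le_max (by linarith) le_rfl

/-- A subsolution of the search equation lies below its solution. -/
theorem le_searchValue {δ : ℝ} (hδ0 : 0 < δ) (hδ1 : δ < 1) {G : Measure ℝ}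
    [IsProbabilityMeasure G] (hG : Integrable (fun m : ℝ => m) G) {u : ℝ}
    (hu : u ≤ δ * u + expectedExcess G (δ * u)) : u ≤ searchValue δ G := by
  have hs := (isSearchValue_iff hG).1 (searchValue_spec hδ0 hδ1 G hG)
  by_contra! h
  have := expectedExcess_sub_le hG (mul_le_mul_of_nonneg_left h.le hδ0.le)
  nlinarith

theorem mean_le_searchValue {δ : ℝ} (hδ0 : 0 < δ) (hδ1 : δ < 1) {G : Measure ℝ}
    [IsProbabilityMeasure G] (hG : Integrable (fun m : ℝ => m) G) :
    ∫ m, m ∂G ≤ searchValue δ G := by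
  have hs := (isSearchValue_iff hG).1 (searchValue_spec hδ0 hδ1 G hG)
  linarith [mean_sub_le_expectedExcess hG (δ * searchValue δ G)]

/-! ### The persuasion problem -/

/-- The expectation under `G` of the payoff `(m - r)⁺ + w 1{m ≤ r}` from the posterior mean `m`:
what a principal who charges the agent's full gain from persuasion obtains, up to a constant, when
the agent's reservation value is `r` and the continuation of search is worth `w`. -/
noncomputable def persuasionValue (r w : ℝ) (G : Measure ℝ) : ℝ :=
  expectedExcess G r + cdf G r * w

/-- The partial expectation `E_H[(θ - r) 1{θ ≤ t}]`. -/
noncomputable def gapBelow (H : Measure ℝ) (r t : ℝ) : ℝ :=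
  ∫ θ in Iic t, (θ - r) ∂H

theorem persuasionValue_eq_integral {G : Measure ℝ} [IsProbabilityMeasure G]
    (hG : Integrable (fun m : ℝ => m) G) (r w : ℝ) :
    persuasionValue r w G =
      ∫ m, (max (m - r) 0 + (Iic r).indicator (fun _ => w) m) ∂G := by
  rw [integral_add (integrable_excess hG r) ((integrable_const w).indicator measurableSet_Iic),
    integral_indicator measurableSet_Iic, setIntegral_const, ← cdf_eq_real, smul_eq_mul]
  rfl

theorem integrable_persuasion {G : Measure ℝ} [IsFiniteMeasure G]
    (hG : Integrable (fun m : ℝ => m) G) (r w : ℝ) :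
    Integrable (fun m => max (m - r) 0 + (Iic r).indicator (fun _ => w) m) G :=
  (integrable_excess hG r).add ((integrable_const w).indicator measurableSet_Iic)

/-- The payoff lies below the convex function `w + (m - r - w)⁺`. -/
theorem persuasionValue_le {G : Measure ℝ} [IsProbabilityMeasure G]
    (hG : Integrable (fun m : ℝ => m) G) (r w : ℝ) :
    persuasionValue r w G ≤ w + expectedExcess G (r + w) := by
  have : w + expectedExcess G (r + w) = ∫ m, (w + max (m - (r + w)) 0) ∂G := by
    rw [integral_add (integrable_const w) (integrable_excess hG _)]
    simp [expectedExcess]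
  rw [this, persuasionValue_eq_integral hG]
  refine integral_mono (integrable_persuasion hG r w)
    ((integrable_const w).add (integrable_excess hG _)) fun m => ?_
  dsimp only
  rcases le_or_gt m r with h | h
  · rw [indicator_of_mem (mem_Iic.2 h), max_eq_right (by linarith)]
    linarith [le_max_right (m - (r + w)) 0]
  · rw [indicator_of_notMem (by simpa using h), max_eq_left (by linarith)]
    linarith [le_max_left (m - (r + w)) 0]

section Gap

theorem gapBelow_self_nonpos (H : Measure ℝ) (r : ℝ) : gapBelow H r r ≤ 0 :=
  setIntegral_nonpos measurableSet_Iic fun θ hθ => by linarith [mem_Iic.1 hθ]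

theorem expectedExcess_eq_setIntegral (H : Measure ℝ) (x : ℝ) :
    expectedExcess H x = ∫ θ in Ioi x, (θ - x) ∂H := by
  rw [expectedExcess, ← integral_indicator measurableSet_Ioi]
  refine integral_congr_ae (Filter.Eventually.of_forall fun θ => ?_)
  dsimp only
  rcases le_or_gt θ x with h | h
  · rw [indicator_of_notMem (by simpa using h), max_eq_right (by linarith)]
  · rw [indicator_of_mem (mem_Ioi.2 h), max_eq_left (by linarith)]

variable {H : Measure ℝ} [IsProbabilityMeasure H]

theorem gapBelow_sub (hH : Integrable (fun m : ℝ => m) H) (r s t : ℝ) :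
    gapBelow H r t - gapBelow H r s = ∫ θ in s..t, (θ - r) ∂H :=
  have h := hH.sub (integrable_const r)
  intervalIntegral.integral_Iic_sub_Iic h.integrableOn h.integrableOn

theorem continuous_gapBelow [NullSingletonClass H] (hH : Integrable (fun m : ℝ => m) H) (r : ℝ) :
    Continuous (gapBelow H r) := by
  have h := hH.sub (integrable_const r)
  have : gapBelow H r = fun t => gapBelow H r r + ∫ θ in r..t, (θ - r) ∂H := by
    funext t
    rw [← gapBelow_sub hH]
    ring
  rw [this]
  exact continuous_const.add
    (intervalIntegral.continuous_primitive (fun _ _ => h.intervalIntegrable) r)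

theorem gapBelow_mono (hH : Integrable (fun m : ℝ => m) H) {r s t : ℝ} (hrs : r ≤ s)
    (hst : s ≤ t) : gapBelow H r s ≤ gapBelow H r t := by
  rw [← sub_nonneg, gapBelow_sub hH, intervalIntegral.integral_of_le hst]
  exact setIntegral_nonneg measurableSet_Ioc fun θ hθ => by linarith [hθ.1]

theorem gapBelow_eq (hH : Integrable (fun m : ℝ => m) H) (r t : ℝ) :
    gapBelow H r t = (∫ θ in Iic t, θ ∂H) - H.real (Iic t) * r := by
  rw [gapBelow, integral_sub hH.integrableOn (integrable_const r), setIntegral_const, smul_eq_mul]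

theorem gapBelow_add_integral_Ioi (hH : Integrable (fun m : ℝ => m) H) (r t : ℝ) :
    gapBelow H r t + ∫ θ in Ioi t, (θ - r) ∂H = (∫ θ, θ ∂H) - r := by
  rw [gapBelow, ← compl_Iic, integral_add_compl measurableSet_Iic (integrable_sub_const hH r),
    integral_sub_const hH]

end Gap

/-! ### Censorship below a cutoff -/

/-- Lower censorship: qualities up to `t` are pooled at `q`, and those above `t` are revealed. -/
noncomputable def censor (t q θ : ℝ) : ℝ :=
  (Iic t).piecewise (fun _ => q) (fun θ => θ) θ

/-- The distribution of posterior means under lower censorship. -/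
noncomputable def censored (H : Measure ℝ) (t q : ℝ) : Measure ℝ :=
  H.map (censor t q)

theorem measurable_censor (t q : ℝ) : Measurable (censor t q) :=
  Measurable.piecewise measurableSet_Iic measurable_const measurable_id

/-- The payoff from lower censorship at `t ≥ r` with a pooled mean of at most `r`: the agent
continues exactly when `θ ≤ t`. -/
noncomputable def cutoffValue (r w t : ℝ) (H : Measure ℝ) : ℝ :=
  H.real (Iic t) * w + ∫ θ in Ioi t, (θ - r) ∂H

section Censorship

variable {H : Measure ℝ} [IsProbabilityMeasure H]

instance (t q : ℝ) : IsProbabilityMeasure (censored H t q) :=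
  Measure.isProbabilityMeasure_map (measurable_censor t q).aemeasurable

theorem integral_censored {f : ℝ → ℝ} (hfi : Integrable f H) (hf : Measurable f) (t q : ℝ) :
    ∫ m, f m ∂(censored H t q) = H.real (Iic t) * f q + ∫ θ in Ioi t, f θ ∂H := by
  rw [censored, integral_map (measurable_censor t q).aemeasurable hf.aestronglyMeasurable,
    show (fun θ => f (censor t q θ)) = (Iic t).piecewise (fun _ => f q) f from
      funext fun θ => by unfold censor; by_cases h : θ ∈ Iic t <;> simp [piecewise, h],
    integral_piecewise measurableSet_Iic integrableOn_const hfi.integrableOn,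
    setIntegral_const, smul_eq_mul, compl_Iic]

theorem carried_censored {a b : ℝ} (hH : H (Icc a b)ᶜ = 0) {t q : ℝ}
    (hq : gapBelow H q t = 0) : censored H t q (Icc a b)ᶜ = 0 := by
  have hid := integrable_id_of_carried hH
  rw [censored, Measure.map_apply (measurable_censor t q) measurableSet_Icc.compl]
  by_cases h0 : H (Iic t) = 0
  · refine measure_mono_null (fun θ hθ => ?_) (measure_union_null h0 hH)
    by_cases h : θ ∈ Iic t
    · exact Or.inl h
    · right
      simpa [censor, piecewise, h] using hθ
  -- The pooled mean lies in the interval because it averages over an event of positive mass.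
  have hp : 0 < H.real (Iic t) := ENNReal.toReal_pos h0 (measure_ne_top _ _)
  have hq' : q ∈ Icc a b := by
    have hae := ae_restrict_of_ae (s := Iic t) (ae_mem_Icc hH)
    rw [gapBelow_eq hid] at hq
    have h1 : H.real (Iic t) * a ≤ ∫ θ in Iic t, θ ∂H := by
      rw [← smul_eq_mul, ← setIntegral_const]
      exact integral_mono_ae (integrable_const a) hid.integrableOn (hae.mono fun _ h => h.1)
    have h2 : ∫ θ in Iic t, θ ∂H ≤ H.real (Iic t) * b := by
      rw [← smul_eq_mul, ← setIntegral_const]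
      exact integral_mono_ae hid.integrableOn (integrable_const b) (hae.mono fun _ h => h.2)
    constructor <;> refine le_of_mul_le_mul_left ?_ hp <;> linarith
  refine measure_mono_null (t := (Icc a b)ᶜ) (fun θ hθ hθ' => hθ ?_) hH
  by_cases h : θ ∈ Iic t
  · simpa [censor, piecewise, h] using hq'
  · simpa [censor, piecewise, h] using hθ'

theorem censored_mem_contractions {a b : ℝ} (hH : H (Icc a b)ᶜ = 0) {t q : ℝ}
    (hq : gapBelow H q t = 0) : censored H t q ∈ contractions a b H := by
  have hid := integrable_id_of_carried hH
  rw [mem_contractions_iff hH]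
  refine ⟨inferInstance, carried_censored hH hq, fun x => ?_, ?_⟩
  · have hi := integrable_excess hid x
    have hqt : H.real (Iic t) * q = ∫ θ in Iic t, θ ∂H := by
      rw [gapBelow_eq hid] at hq
      linarith
    have hgap := gapBelow_eq hid x t
    have hle : gapBelow H x t ≤ ∫ θ in Iic t, max (θ - x) 0 ∂H :=
      integral_mono (hid.sub (integrable_const x)).integrableOn hi.integrableOn
        fun _ => le_max_left _ _
    have h0 : 0 ≤ ∫ θ in Iic t, max (θ - x) 0 ∂H := integral_nonneg fun _ => le_max_right _ _
    have hsplit := integral_add_compl (measurableSet_Iic (a := t)) hi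
    rw [compl_Iic] at hsplit
    rw [expectedExcess, expectedExcess,
      integral_censored hi ((measurable_id.sub_const x).max measurable_const), ← hsplit]
    refine add_le_add_left ?_ _
    rcases le_total (q - x) 0 with h | h
    · rw [max_eq_right h, mul_zero]
      exact h0
    · rw [max_eq_left h]
      linarith
  · rw [integral_censored hid measurable_id]
    have := gapBelow_add_integral_Ioi hid 0 t
    rw [gapBelow_eq hid] at this hq
    simp only [sub_zero, mul_zero] at this
    linarith

theorem persuasionValue_censored {a b : ℝ} (hH : H (Icc a b)ᶜ = 0) {t q r w : ℝ}
    (hq : gapBelow H q t = 0) (hqr : q ≤ r) (hrt : r ≤ t) :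
    persuasionValue r w (censored H t q) = cutoffValue r w t H := by
  have hid := integrable_id_of_carried hH
  rw [persuasionValue_eq_integral (integrable_id_of_carried (carried_censored hH hq)),
    integral_censored (integrable_persuasion hid r w)
      (((measurable_id.sub_const r).max measurable_const).add
        (measurable_const.indicator measurableSet_Iic)),
    indicator_of_mem (mem_Iic.2 hqr), max_eq_right (by linarith), zero_add, cutoffValue]
  congr 1
  refine setIntegral_congr_fun measurableSet_Ioi fun θ hθ => ?_
  have : r < θ := hrt.trans_lt hθ
  simp [this, this.le]

/-- Censorship at `r + w`, the full-surplus cutoff, attains the upper bound of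
`persuasionValue_le`. -/
theorem cutoffValue_top (hid : Integrable (fun m : ℝ => m) H) (r w : ℝ) :
    cutoffValue r w (r + w) H = w + expectedExcess H (r + w) := by
  have h1 : ∫ θ in Ioi (r + w), (θ - r) ∂H =
      (∫ θ in Ioi (r + w), (θ - (r + w)) ∂H) + H.real (Ioi (r + w)) * w := by
    rw [← smul_eq_mul, ← setIntegral_const, ← integral_add
      (integrable_sub_const hid _).integrableOn (integrable_const w)]
    exact integral_congr_ae (Filter.Eventually.of_forall fun θ => by dsimp only; ring)
  have h2 : H.real (Iic (r + w)) + H.real (Ioi (r + w)) = 1 := by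
    rw [← compl_Iic, measureReal_add_measureReal_compl measurableSet_Iic, probReal_univ]
  rw [cutoffValue, h1, ← expectedExcess_eq_setIntegral]
  linear_combination w * h2

end Censorship

/-! ### Optimal persuasion -/

theorem exists_pooled_mean {H : Measure ℝ} [IsProbabilityMeasure H]
    (hid : Integrable (fun m : ℝ => m) H) {r t : ℝ} (h : gapBelow H r t ≤ 0) :
    ∃ q ≤ r, gapBelow H q t = 0 := by
  rcases eq_or_ne (H.real (Iic t)) 0 with h0 | h0
  · refine ⟨r, le_rfl, ?_⟩
    rw [gapBelow, Measure.restrict_eq_zero.2 ((measureReal_eq_zero_iff).1 h0),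
      integral_zero_measure]
  · have hp : 0 < H.real (Iic t) := lt_of_le_of_ne measureReal_nonneg h0.symm
    rw [gapBelow_eq hid] at h
    refine ⟨(∫ θ in Iic t, θ ∂H) / H.real (Iic t), ?_, ?_⟩
    · rw [div_le_iff₀ hp]
      linarith
    · rw [gapBelow_eq hid]
      field_simp
      ring

theorem expectedExcess_eq_of_gapBelow_eq_zero {H : Measure ℝ} [IsProbabilityMeasure H]
    (hid : Integrable (fun m : ℝ => m) H) {r t : ℝ} (h : gapBelow H r t = 0) :
    expectedExcess H t = (∫ θ, θ ∂H) - r - (1 - H.real (Iic t)) * (t - r) := by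
  have h1 := gapBelow_add_integral_Ioi hid t t
  rw [← expectedExcess_eq_setIntegral, gapBelow_eq hid] at h1
  rw [gapBelow_eq hid] at h
  linarith

/-- If `H` puts no mass on `(-∞, r]`, then neither does a mean-preserving contraction of `H`:
even an atom at `r` is excluded, although `r` may be the lower end of the support of `H`. -/
theorem cdf_eq_zero_of_mem_contractions {a b : ℝ} {H : Measure ℝ} [IsProbabilityMeasure H]
    (hH : H (Icc a b)ᶜ = 0) {G : Measure ℝ} (hG : G ∈ contractions a b H) {r : ℝ}
    (h0 : cdf H r = 0) : cdf G r = 0 := by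
  obtain ⟨hGp, hGc, hle, hmean⟩ := (mem_contractions_iff hH).1 hG
  have hHid := integrable_id_of_carried hH
  have hGid := integrable_id_of_carried hGc
  have hHge : ∀ᵐ θ ∂H, r < θ := by
    rw [cdf_eq_real, measureReal_eq_zero_iff] at h0
    exact (measure_eq_zero_iff_ae_notMem.1 h0).mono fun θ hθ => by simpa using hθ
  have hHr : expectedExcess H r = (∫ θ, θ ∂H) - r := by
    rw [← integral_sub_const hHid]
    exact integral_congr_ae (hHge.mono fun θ hθ => max_eq_left (by linarith))
  -- The bound `1{m ≤ r} ≤ (y - m)⁺ / (y - r)` passes to the convex order.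
  have hstep : ∀ y, r < y → cdf G r ≤ cdf H y := by
    intro y hy
    have hG1 : (y - r) * cdf G r ≤ y - (∫ m, m ∂G) + expectedExcess G y := by
      have hi : Integrable (fun m : ℝ => max (m - y) 0 - (m - y)) G :=
        (integrable_excess hGid y).sub (integrable_sub_const hGid y)
      have e : y - (∫ m, m ∂G) + expectedExcess G y = ∫ m, (max (m - y) 0 - (m - y)) ∂G := by
        rw [integral_sub (integrable_excess hGid y) (integrable_sub_const hGid y),
          integral_sub_const hGid, expectedExcess]
        ring
      rw [e, cdf_eq_real, mul_comm, ← smul_eq_mul, ← setIntegral_const,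
        ← integral_indicator measurableSet_Iic]
      refine integral_mono ((integrable_const _).indicator measurableSet_Iic) hi fun m => ?_
      dsimp only
      rcases le_or_gt m r with h | h
      · rw [indicator_of_mem (mem_Iic.2 h)]
        linarith [le_max_right (m - y) 0]
      · rw [indicator_of_notMem (by simpa using h)]
        linarith [le_max_left (m - y) 0]
    have hH1 : expectedExcess H r - expectedExcess H y ≥ (y - r) * (1 - cdf H y) := by
      have e : (y - r) * (1 - cdf H y) = ∫ _ in Ioi y, (y - r) ∂H := by
        rw [setIntegral_const, smul_eq_mul, ← compl_Iic,
          probReal_compl_eq_one_sub measurableSet_Iic, cdf_eq_real, mul_comm]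
      rw [e, expectedExcess, expectedExcess, ← integral_sub (integrable_excess hHid r)
        (integrable_excess hHid y), ← integral_indicator measurableSet_Ioi]
      refine integral_mono ((integrable_const _).indicator measurableSet_Ioi)
        ((integrable_excess hHid r).sub (integrable_excess hHid y)) fun m => ?_
      dsimp only
      rcases le_or_gt m y with h | h
      · rw [indicator_of_notMem (by simpa using h), sub_nonneg]
        exact max_le_max (by linarith) le_rfl
      · rw [indicator_of_mem (mem_Ioi.2 h), max_eq_left (by linarith), max_eq_left (by linarith)]
        linarith
    have := hle y
    refine le_of_mul_le_mul_left ?_ (sub_pos.2 hy)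
    linarith
  refine le_antisymm ?_ (cdf_nonneg G r)
  have hcont : Filter.Tendsto (cdf H) (nhdsWithin r (Ioi r)) (nhds (cdf H r)) :=
    ((cdf H).right_continuous r).mono_left (nhdsWithin_mono r Ioi_subset_Ici_self)
  rw [← h0]
  exact ge_of_tendsto hcont (by filter_upwards [self_mem_nhdsWithin] with y hy using hstep y hy)

/-- Optimality of censorship at a cutoff `t ∈ [r, r + w]` whose pooled mean is `r`. For `t > r` the
multiplier is the convex function that agrees with `m - r` above `t` and is affine below `t`, with
value `w` at `r`: it dominates the payoff, and agrees with it on the pooled mean and above `t`. -/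
theorem persuasionValue_le_cutoffValue {a b : ℝ} {H : Measure ℝ} [IsProbabilityMeasure H]
    (hH : H (Icc a b)ᶜ = 0) (hatom : ∀ x, H {x} = 0) {G : Measure ℝ}
    (hG : G ∈ contractions a b H) {r w t : ℝ} (hrt : r ≤ t) (htw : t ≤ r + w)
    (ht : gapBelow H r t = 0) : persuasionValue r w G ≤ cutoffValue r w t H := by
  obtain ⟨hGp, hGc, hle, hmean⟩ := (mem_contractions_iff hH).1 hG
  have hHid := integrable_id_of_carried hH
  have hGid := integrable_id_of_carried hGc
  have hI := gapBelow_add_integral_Ioi hHid r t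
  rw [ht, zero_add] at hI
  rcases hrt.eq_or_lt with rfl | hlt
  · -- Here no quality lies below `r`, so nothing is pooled and every draw is accepted.
    have h0 : cdf H r = 0 := by
      have hi : IntegrableOn (fun θ => r - θ) (Iic r) H :=
        ((integrable_const r).sub hHid).integrableOn
      have hz : ∫ θ in Iic r, (r - θ) ∂H = 0 := by
        rw [← neg_eq_zero, ← integral_neg]
        simpa [gapBelow] using ht
      rw [setIntegral_eq_zero_iff_of_nonneg_ae ?_ hi] at hz
      · rw [cdf_eq_real, measureReal_eq_zero_iff]
        have h1 : ∀ᵐ θ ∂H, θ ∈ Iic r → r - θ = 0 := (ae_restrict_iff' measurableSet_Iic).1 hz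
        have h2 := measure_eq_zero_iff_ae_notMem.1 (hatom r)
        rw [measure_eq_zero_iff_ae_notMem]
        filter_upwards [h1, h2] with θ h1 h2 h3
        exact h2 (by simpa using (sub_eq_zero.1 (h1 h3)).symm)
      · filter_upwards [ae_restrict_mem measurableSet_Iic] with θ hθ
        exact sub_nonneg.2 hθ
    rw [persuasionValue, cdf_eq_zero_of_mem_contractions hH hG h0, cutoffValue, ← cdf_eq_real, h0,
      ← expectedExcess_eq_setIntegral]
    linarith [hle r]
  have hd : 0 < t - r := sub_pos.2 hlt
  obtain ⟨κ, hκ⟩ : ∃ κ, κ * (t - r) = w := ⟨w / (t - r), div_mul_cancel₀ _ hd.ne'⟩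
  have hκ1 : 1 ≤ κ := le_of_mul_le_mul_right (by linarith) hd
  have hai : Integrable (fun m => w + (1 - κ) * (m - r)) G :=
    (integrable_const w).add ((integrable_sub_const hGid r).const_mul (1 - κ))
  have hψi : Integrable (fun m => w + (1 - κ) * (m - r) + κ * max (m - t) 0) G :=
    hai.add ((integrable_excess hGid t).const_mul κ)
  have hψ : ∫ m, (w + (1 - κ) * (m - r) + κ * max (m - t) 0) ∂G =
      w + (1 - κ) * ((∫ m, m ∂G) - r) + κ * expectedExcess G t := by
    rw [integral_add hai ((integrable_excess hGid t).const_mul κ), integral_add (integrable_const w)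
      ((integrable_sub_const hGid r).const_mul (1 - κ)), integral_const_mul, integral_const_mul,
      integral_sub_const hGid, expectedExcess]
    simp
  calc persuasionValue r w G
      ≤ w + (1 - κ) * ((∫ m, m ∂G) - r) + κ * expectedExcess G t := by
        rw [persuasionValue_eq_integral hGid, ← hψ]
        refine integral_mono (integrable_persuasion hGid r w) hψi fun m => ?_
        dsimp only
        rcases le_or_gt m r with h | h
        · rw [indicator_of_mem (mem_Iic.2 h), max_eq_right (by linarith),
            max_eq_right (by linarith)]
          nlinarith
        rw [indicator_of_notMem (by simpa using h), max_eq_left (by linarith)]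
        rcases le_total m t with h' | h'
        · rw [max_eq_right (by linarith)]
          nlinarith
        · rw [max_eq_left (by linarith)]
          nlinarith
    _ ≤ w + (1 - κ) * ((∫ m, m ∂H) - r) + κ * expectedExcess H t := by
        rw [hmean]
        have := mul_le_mul_of_nonneg_left (hle t) (zero_le_one.trans hκ1)
        linarith
    _ = cutoffValue r w t H := by
        rw [expectedExcess_eq_of_gapBelow_eq_zero hHid ht, cutoffValue, hI]
        linear_combination (H.real (Iic t) - 1) * hκ

/-- Pooling fewer qualities than those below the full-surplus cutoff `r + w` costs the principal,
as qualities between the two cutoffs would better be rejected. -/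
theorem cutoffValue_lt {H : Measure ℝ} [IsProbabilityMeasure H]
    (hid : Integrable (fun m : ℝ => m) H) (hatom : ∀ x, H {x} = 0) {r w t : ℝ}
    (htw : t ≤ r + w) (hgap : gapBelow H r t < gapBelow H r (r + w)) :
    cutoffValue r w t H < w + expectedExcess H (r + w) := by
  have hi : Integrable (fun θ => r + w - θ) H := (integrable_const _).sub hid
  have hdiff : cutoffValue r w (r + w) H - cutoffValue r w t H =
      ∫ θ in Ioc t (r + w), (r + w - θ) ∂H := by
    have h1 := gapBelow_add_integral_Ioi hid r t
    have h2 := gapBelow_add_integral_Ioi hid r (r + w)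
    have h3 := gapBelow_sub hid (r + w) t (r + w)
    rw [intervalIntegral.integral_of_le htw] at h3
    have h4 : ∫ θ in Ioc t (r + w), (r + w - θ) ∂H = -∫ θ in Ioc t (r + w), (θ - (r + w)) ∂H := by
      rw [← integral_neg]
      simp
    rw [h4, ← h3, cutoffValue, cutoffValue]
    simp only [gapBelow_eq hid] at h1 h2 ⊢
    linarith
  have hnn : 0 ≤ᵐ[H.restrict (Ioc t (r + w))] fun θ => r + w - θ := by
    filter_upwards [ae_restrict_mem measurableSet_Ioc] with θ hθ
    exact sub_nonneg.2 hθ.2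
  rw [← cutoffValue_top hid, ← sub_pos, hdiff]
  refine lt_of_le_of_ne (integral_nonneg_of_ae hnn) fun h0 => hgap.ne ?_
  rw [eq_comm, setIntegral_eq_zero_iff_of_nonneg_ae hnn hi.integrableOn] at h0
  -- Equality would concentrate the mass of `(t, r + w]` on the null set `{r + w}`.
  have h1 : ∀ᵐ θ ∂H, θ ∈ Ioc t (r + w) → r + w - θ = 0 :=
    (ae_restrict_iff' measurableSet_Ioc).1 h0
  have h2 : H (Ioc t (r + w)) = 0 := by
    rw [measure_eq_zero_iff_ae_notMem]
    filter_upwards [h1, measure_eq_zero_iff_ae_notMem.1 (hatom (r + w))] with θ h1 h2 h3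
    exact h2 (by simpa using (sub_eq_zero.1 (h1 h3)).symm)
  have h3 := gapBelow_sub hid r t (r + w)
  rw [intervalIntegral.integral_of_le htw, Measure.restrict_eq_zero.2 h2,
    integral_zero_measure] at h3
  linarith

/-- The persuasion problem has a solution; its value attains the upper bound of
`persuasionValue_le` if and only if `E_H[(θ - r) 1{θ ≤ r + w}] ≤ 0`. -/
theorem exists_optimal_contraction {a b : ℝ} {H : Measure ℝ} [IsProbabilityMeasure H]
    (hH : H (Icc a b)ᶜ = 0) (hatom : ∀ x, H {x} = 0) (r : ℝ) {w : ℝ} (hw : 0 ≤ w) :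
    ∃ G ∈ contractions a b H,
      (∀ G' ∈ contractions a b H, persuasionValue r w G' ≤ persuasionValue r w G) ∧
      (persuasionValue r w G = w + expectedExcess H (r + w) ↔ gapBelow H r (r + w) ≤ 0) := by
  have hid := integrable_id_of_carried hH
  by_cases hgap : gapBelow H r (r + w) ≤ 0
  · obtain ⟨q, hqr, hq⟩ := exists_pooled_mean hid hgap
    have hval : persuasionValue r w (censored H (r + w) q) = w + expectedExcess H (r + w) := by
      rw [persuasionValue_censored hH hq hqr (by linarith), cutoffValue_top hid]
    refine ⟨_, censored_mem_contractions hH hq, fun G' hG' => ?_, iff_of_true hval hgap⟩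
    obtain ⟨hp, hc, hle, -⟩ := (mem_contractions_iff hH).1 hG'
    rw [hval]
    linarith [persuasionValue_le (integrable_id_of_carried hc) r w, hle (r + w)]
  · have : NullSingletonClass H := ⟨hatom⟩
    rw [not_le] at hgap
    obtain ⟨t, ⟨hrt, htw⟩, ht⟩ := intermediate_value_Icc (show r ≤ r + w by linarith)
      (continuous_gapBelow hid r).continuousOn ⟨gapBelow_self_nonpos H r, hgap.le⟩
    have hval := persuasionValue_censored (w := w) hH ht le_rfl hrt
    refine ⟨_, censored_mem_contractions hH ht, fun G' hG' => ?_, iff_of_false ?_ hgap.not_ge⟩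
    · rw [hval]
      exact persuasionValue_le_cutoffValue hH hatom hG' hrt htw ht
    · rw [hval]
      exact (cutoffValue_lt hid hatom htw (ht ▸ hgap)).ne

/-! ### Interim beliefs and the law of the public posterior mean -/

section PublicSignalLaws

variable {Z : Type*} [MeasurableSpace Z] {F : Measure ℝ} [IsProbabilityMeasure F]
  {ξ : Kernel ℝ Z} [IsMarkovKernel ξ] {B : Kernel Z ℝ} {θlo θhi : ℝ}

instance : IsProbabilityMeasure (signalLaw F ξ) := by
  unfold signalLaw
  infer_instance

namespace IsInterimBelief

/-- Bayes plausibility: the interim beliefs average to the prior. -/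
theorem snd_compProd (hB : IsInterimBelief θlo θhi F ξ B) :
    ((signalLaw F ξ).compProd B).snd = F := by
  rw [hB.bayes, Measure.snd_map_swap, Measure.fst_compProd]

theorem integrable_integral (hB : IsInterimBelief θlo θhi F ξ B) {f : ℝ → ℝ}
    (hf : Integrable f F) : Integrable (fun z => ∫ θ, f θ ∂(B z)) (signalLaw F ξ) := by
  have := hB.isMarkovKernel
  have h : Integrable (fun x : Z × ℝ => f x.2) ((signalLaw F ξ).compProd B) := by
    rw [← hB.snd_compProd] at hf
    exact hf.comp_measurable measurable_snd
  exact Integrable.integral_compProd h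

theorem integral_integral (hB : IsInterimBelief θlo θhi F ξ B) {f : ℝ → ℝ}
    (hf : Integrable f F) : ∫ z, ∫ θ, f θ ∂(B z) ∂(signalLaw F ξ) = ∫ θ, f θ ∂F := by
  have := hB.isMarkovKernel
  have hf' := hf
  rw [← hB.snd_compProd] at hf'
  have h : Integrable (fun x : Z × ℝ => f x.2) ((signalLaw F ξ).compProd B) :=
    hf'.comp_measurable measurable_snd
  rw [← Measure.integral_compProd h]
  conv_rhs => rw [← hB.snd_compProd]
  rw [Measure.snd, integral_map measurable_snd.aemeasurable hf'.aestronglyMeasurable]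

theorem integrable_mean (hB : IsInterimBelief θlo θhi F ξ B)
    (hF : Integrable (fun θ : ℝ => θ) F) :
    Integrable (fun z => ∫ θ, θ ∂(B z)) (signalLaw F ξ) :=
  hB.integrable_integral hF

theorem isProbabilityMeasure_publicMeanLaw (hB : IsInterimBelief θlo θhi F ξ B)
    (hF : Integrable (fun θ : ℝ => θ) F) : IsProbabilityMeasure (publicMeanLaw F ξ B) :=
  Measure.isProbabilityMeasure_map (hB.integrable_mean hF).aemeasurable

theorem integrable_publicMeanLaw (hB : IsInterimBelief θlo θhi F ξ B)
    (hF : Integrable (fun θ : ℝ => θ) F) :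
    Integrable (fun m : ℝ => m) (publicMeanLaw F ξ B) :=
  (integrable_map_measure measurable_id.aestronglyMeasurable
    (hB.integrable_mean hF).aemeasurable).2 (hB.integrable_mean hF)

theorem integrable_autarky (hB : IsInterimBelief θlo θhi F ξ B)
    (hF : Integrable (fun θ : ℝ => θ) F) (x : ℝ) :
    Integrable (fun z => max ((∫ θ, θ ∂(B z)) - x) 0) (signalLaw F ξ) :=
  ((hB.integrable_mean hF).sub (integrable_const x)).sup (integrable_const 0)

theorem expectedExcess_publicMeanLaw (hB : IsInterimBelief θlo θhi F ξ B)
    (hF : Integrable (fun θ : ℝ => θ) F) (x : ℝ) :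
    expectedExcess (publicMeanLaw F ξ B) x =
      ∫ z, max ((∫ θ, θ ∂(B z)) - x) 0 ∂(signalLaw F ξ) :=
  integral_map (hB.integrable_mean hF).aemeasurable
    ((measurable_id.sub_const x).max measurable_const).aestronglyMeasurable

theorem integrable_expectedExcess (hB : IsInterimBelief θlo θhi F ξ B)
    (hF : Integrable (fun θ : ℝ => θ) F) (x : ℝ) :
    Integrable (fun z => expectedExcess (B z) x) (signalLaw F ξ) :=
  hB.integrable_integral (integrable_excess hF x)

theorem integral_expectedExcess (hB : IsInterimBelief θlo θhi F ξ B)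
    (hF : Integrable (fun θ : ℝ => θ) F) (x : ℝ) :
    ∫ z, expectedExcess (B z) x ∂(signalLaw F ξ) = expectedExcess F x :=
  hB.integral_integral (integrable_excess hF x)

theorem integral_const_add_expectedExcess (hB : IsInterimBelief θlo θhi F ξ B)
    (hF : Integrable (fun θ : ℝ => θ) F) (w x : ℝ) :
    ∫ z, (w + expectedExcess (B z) x) ∂(signalLaw F ξ) = w + expectedExcess F x := by
  rw [integral_add (integrable_const w) (hB.integrable_expectedExcess hF x),
    hB.integral_expectedExcess hF]
  simp

theorem searchValue_publicMeanLaw_le (hB : IsInterimBelief θlo θhi F ξ B)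
    (hF : Integrable (fun θ : ℝ => θ) F) {δ : ℝ} (hδ0 : 0 < δ) (hδ1 : δ < 1) :
    searchValue δ (publicMeanLaw F ξ B) ≤ searchValue δ F := by
  have := hB.isProbabilityMeasure_publicMeanLaw hF
  have := hB.isMarkovKernel
  have hi := hB.integrable_publicMeanLaw hF
  have hs := (isSearchValue_iff hi).1 (searchValue_spec hδ0 hδ1 _ hi)
  refine le_searchValue hδ0 hδ1 hF (hs.le.trans ?_)
  rw [hB.expectedExcess_publicMeanLaw hF, ← hB.integral_expectedExcess hF]
  exact add_le_add_right (integral_mono (hB.integrable_autarky hF _)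
    (hB.integrable_expectedExcess hF _) fun z =>
      max_mean_sub_le_expectedExcess (integrable_id_of_carried (hB.carried z)) _) _

end IsInterimBelief

end PublicSignalLaws

/-! ### Stationary equilibria -/

section Equilibria

variable {Z : Type*} [MeasurableSpace Z] {F : Measure ℝ} {ξ : Kernel ℝ Z} {B : Kernel Z ℝ}
  {θlo θhi : ℝ}

theorem accepts_iff {δ U p : ℝ} {H : Measure ℝ} [IsProbabilityMeasure H]
    (hH : H (Icc θlo θhi)ᶜ = 0) {G : Measure ℝ} (hG : G ∈ contractions θlo θhi H) :
    Accepts θhi δ U H p G ↔ p ≤ expectedExcess G (δ * U) - max ((∫ θ, θ ∂H) - δ * U) 0 := by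
  have := hG.1
  rw [Accepts, incrementalBenefit_eq hG.2.1, incrementalBenefit_uninformative hH]

/-- The highest acceptable price for a contraction is never negative. -/
theorem autarky_le_of_mem_contractions {H : Measure ℝ} [IsProbabilityMeasure H]
    (hH : H (Icc θlo θhi)ᶜ = 0) {G : Measure ℝ} (hG : G ∈ contractions θlo θhi H) (x : ℝ) :
    max ((∫ θ, θ ∂H) - x) 0 ≤ expectedExcess G x := by
  obtain ⟨hGp, hGc, -, hmean⟩ := (mem_contractions_iff hH).1 hG
  rw [← hmean]
  exact max_mean_sub_le_expectedExcess (integrable_id_of_carried hGc) x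

theorem profit_eq_persuasionValue_sub (δ U V A : ℝ) (G : Measure ℝ) :
    profit δ U V (expectedExcess G (δ * U) - A) G = persuasionValue (δ * U) (δ * V) G - A := by
  rw [profit, persuasionValue]
  ring

namespace IsStationaryEquilibrium

variable {δ U V : ℝ} {p : Z → ℝ} {G : Z → Measure ℝ}

/-- The agent's participation constraint binds. -/
theorem price_eq (h : IsStationaryEquilibrium θlo θhi δ F ξ B U V p G)
    (hB : IsInterimBelief θlo θhi F ξ B) (z : Z) :
    p z = expectedExcess (G z) (δ * U) - max ((∫ θ, θ ∂(B z)) - δ * U) 0 := by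
  have := hB.isMarkovKernel
  have hG := h.mem_contractions z
  have hacc := (accepts_iff (hB.carried z) hG).1 (h.accepts z)
  have := h.profit_max z _ ((h.price_nonneg z).trans hacc) _ hG
    ((accepts_iff (hB.carried z) hG).2 le_rfl)
  unfold profit at this
  linarith

theorem profit_eq (h : IsStationaryEquilibrium θlo θhi δ F ξ B U V p G)
    (hB : IsInterimBelief θlo θhi F ξ B) (z : Z) :
    profit δ U V (p z) (G z) =
      persuasionValue (δ * U) (δ * V) (G z) - max ((∫ θ, θ ∂(B z)) - δ * U) 0 := by
  rw [h.price_eq hB z, profit_eq_persuasionValue_sub]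

/-- The contract of each realization solves the persuasion problem. -/
theorem isMax_persuasionValue (h : IsStationaryEquilibrium θlo θhi δ F ξ B U V p G)
    (hB : IsInterimBelief θlo θhi F ξ B) (z : Z) {G' : Measure ℝ}
    (hG' : G' ∈ contractions θlo θhi (B z)) :
    persuasionValue (δ * U) (δ * V) G' ≤ persuasionValue (δ * U) (δ * V) (G z) := by
  have := hB.isMarkovKernel
  have := h.profit_max z _ (sub_nonneg.2 (autarky_le_of_mem_contractions (hB.carried z) hG' _)) _
    hG' ((accepts_iff (hB.carried z) hG').2 le_rfl)
  rw [h.profit_eq hB, profit_eq_persuasionValue_sub] at this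
  linarith

/-- Realization by realization, the principal cannot do better than to extract all gains from
efficient search. -/
theorem persuasionValue_le_efficient (h : IsStationaryEquilibrium θlo θhi δ F ξ B U V p G)
    (hB : IsInterimBelief θlo θhi F ξ B) (z : Z) :
    persuasionValue (δ * U) (δ * V) (G z) ≤ δ * V + expectedExcess (B z) (δ * (U + V)) := by
  have := hB.isMarkovKernel
  obtain ⟨hp, hc, hle, -⟩ := (mem_contractions_iff (hB.carried z)).1 (h.mem_contractions z)
  rw [mul_add]
  linarith [PersuadedSearch.persuasionValue_le (integrable_id_of_carried hc) (δ * U) (δ * V),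
    hle (δ * U + δ * V)]

variable [IsProbabilityMeasure F] [IsMarkovKernel ξ]

/-- As the participation constraint binds, the agent obtains his autarky payoff. -/
theorem agent_value_eq (h : IsStationaryEquilibrium θlo θhi δ F ξ B U V p G)
    (hB : IsInterimBelief θlo θhi F ξ B) (hF : Integrable (fun θ : ℝ => θ) F)
    (hδ0 : 0 < δ) (hδ1 : δ < 1) : U = searchValue δ (publicMeanLaw F ξ B) := by
  have := hB.isProbabilityMeasure_publicMeanLaw hF
  have hi := hB.integrable_publicMeanLaw hF
  refine IsSearchValue.eq_searchValue hδ0 hδ1 hi ((isSearchValue_iff hi).2 ?_)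
  have hU := h.self_generating_agent
  have hz : ∀ z, δ * U + incrementalBenefit θhi (G z) (δ * U) - p z =
      δ * U + max ((∫ θ, θ ∂(B z)) - δ * U) 0 := fun z => by
    have hG := h.mem_contractions z
    have := hG.1
    rw [h.price_eq hB, incrementalBenefit_eq hG.2.1]
    ring
  simp_rw [hz] at hU
  rw [integral_add (integrable_const _) (hB.integrable_autarky hF _),
    ← hB.expectedExcess_publicMeanLaw hF] at hU
  simpa using hU

theorem principal_value_nonneg (h : IsStationaryEquilibrium θlo θhi δ F ξ B U V p G)
    (hδ0 : 0 < δ) (hδ1 : δ < 1) : 0 ≤ V := by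
  by_contra! hV
  have hle : δ * V ≤ V := by
    calc δ * V = ∫ _, δ * V ∂(signalLaw F ξ) := by simp
      _ ≤ ∫ z, profit δ U V (p z) (G z) ∂(signalLaw F ξ) := by
        refine integral_mono (integrable_const _) h.integrable_principal fun z => ?_
        have h1 := h.price_nonneg z
        have h2 := cdf_le_one (G z) (δ * U)
        have h3 : δ * V < 0 := mul_neg_of_pos_of_neg hδ0 hV
        dsimp only [profit]
        nlinarith
      _ = V := h.self_generating_principal.symm
  nlinarith

theorem integrable_persuasionValue (h : IsStationaryEquilibrium θlo θhi δ F ξ B U V p G)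
    (hB : IsInterimBelief θlo θhi F ξ B) (hF : Integrable (fun θ : ℝ => θ) F) :
    Integrable (fun z => persuasionValue (δ * U) (δ * V) (G z)) (signalLaw F ξ) := by
  refine (h.integrable_principal.add (hB.integrable_autarky hF (δ * U))).congr
    (Filter.Eventually.of_forall fun z => ?_)
  simp [h.profit_eq hB z]

theorem total_value_eq (h : IsStationaryEquilibrium θlo θhi δ F ξ B U V p G)
    (hB : IsInterimBelief θlo θhi F ξ B) (hF : Integrable (fun θ : ℝ => θ) F)
    (hδ0 : 0 < δ) (hδ1 : δ < 1) :
    U + V = δ * U + ∫ z, persuasionValue (δ * U) (δ * V) (G z) ∂(signalLaw F ξ) := by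
  have := hB.isProbabilityMeasure_publicMeanLaw hF
  have hi := hB.integrable_publicMeanLaw hF
  have hU := (isSearchValue_iff hi).1 (searchValue_spec hδ0 hδ1 _ hi)
  rw [← h.agent_value_eq hB hF hδ0 hδ1, hB.expectedExcess_publicMeanLaw hF] at hU
  have hV := h.self_generating_principal
  simp_rw [h.profit_eq hB] at hV
  rw [integral_sub (h.integrable_persuasionValue hB hF) (hB.integrable_autarky hF _)] at hV
  linarith

theorem total_value_le (h : IsStationaryEquilibrium θlo θhi δ F ξ B U V p G)
    (hB : IsInterimBelief θlo θhi F ξ B) (hF : Integrable (fun θ : ℝ => θ) F)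
    (hδ0 : 0 < δ) (hδ1 : δ < 1) : U + V ≤ searchValue δ F := by
  refine le_searchValue hδ0 hδ1 hF ?_
  have hle : ∫ z, persuasionValue (δ * U) (δ * V) (G z) ∂(signalLaw F ξ) ≤
      δ * V + expectedExcess F (δ * (U + V)) := by
    rw [← hB.integral_const_add_expectedExcess hF]
    exact integral_mono (h.integrable_persuasionValue hB hF)
      ((integrable_const _).add (hB.integrable_expectedExcess hF _))
      (h.persuasionValue_le_efficient hB)
  linarith [h.total_value_eq hB hF hδ0 hδ1]

/-- The total value is efficient exactly if the pointwise bound of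
`persuasionValue_le_efficient` is attained almost everywhere, that is, if the solution of almost
every persuasion problem attains it. -/
theorem total_value_eq_iff (h : IsStationaryEquilibrium θlo θhi δ F ξ B U V p G)
    (hB : IsInterimBelief θlo θhi F ξ B) (hF : Integrable (fun θ : ℝ => θ) F)
    (hatom : ∀ z x, B z {x} = 0) (hδ0 : 0 < δ) (hδ1 : δ < 1) :
    U + V = searchValue δ F ↔
      ∀ᵐ z ∂(signalLaw F ξ), gapBelow (B z) (δ * U) (δ * (U + V)) ≤ 0 := by
  have := hB.isMarkovKernel
  have hw : 0 ≤ δ * V := mul_nonneg hδ0.le (h.principal_value_nonneg hδ0 hδ1)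
  have hpt : ∀ z, persuasionValue (δ * U) (δ * V) (G z) =
      δ * V + expectedExcess (B z) (δ * (U + V)) ↔
        gapBelow (B z) (δ * U) (δ * (U + V)) ≤ 0 := fun z => by
    obtain ⟨G', hG', hmax, hiff⟩ :=
      exists_optimal_contraction (hB.carried z) (hatom z) (δ * U) hw
    rw [le_antisymm (hmax _ (h.mem_contractions z)) (h.isMax_persuasionValue hB z hG'), mul_add]
    exact hiff
  have hi := h.integrable_persuasionValue hB hF
  have hi' : Integrable (fun z => δ * V + expectedExcess (B z) (δ * (U + V))) (signalLaw F ξ) :=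
    (integrable_const _).add (hB.integrable_expectedExcess hF _)
  have hae := integral_eq_iff_of_ae_le hi hi'
    (Filter.Eventually.of_forall (h.persuasionValue_le_efficient hB))
  rw [hB.integral_const_add_expectedExcess hF] at hae
  have htot := h.total_value_eq hB hF hδ0 hδ1
  have hsol : U + V = searchValue δ F ↔
      U + V = δ * (U + V) + expectedExcess F (δ * (U + V)) :=
    ⟨fun e => by rw [e]; exact (isSearchValue_iff hF).1 (searchValue_spec hδ0 hδ1 F hF),
      fun e => ((isSearchValue_iff hF).2 e).eq_searchValue hδ0 hδ1 hF⟩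
  rw [hsol, ← Filter.eventually_congr (Filter.Eventually.of_forall hpt)]
  refine Iff.trans ⟨fun e => ?_, fun e => ?_⟩ hae <;> linarith

end IsStationaryEquilibrium

/-- If the condition holds almost everywhere, then solutions of the persuasion problems, sold at the
highest acceptable price, form an equilibrium with full extraction. On the exceptional null set
the problems still need solutions, though these may fall short of the efficient bound. -/
theorem exists_isStationaryEquilibrium [IsProbabilityMeasure F] [IsMarkovKernel ξ]
    (hB : IsInterimBelief θlo θhi F ξ B)
    (hF : Integrable (fun θ : ℝ => θ) F) (hatom : ∀ z x, B z {x} = 0) {δ : ℝ} (hδ0 : 0 < δ)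
    (hδ1 : δ < 1)
    (hgap : ∀ᵐ z ∂(signalLaw F ξ), gapBelow (B z)
      (reservationValue δ (publicMeanLaw F ξ B)) (reservationValue δ F) ≤ 0) :
    ∃ (U V : ℝ) (p : Z → ℝ) (G : Z → Measure ℝ),
      IsStationaryEquilibrium θlo θhi δ F ξ B U V p G ∧
      ExtractsEfficientSurplus δ F (publicMeanLaw F ξ B) V := by
  have := hB.isMarkovKernel
  have := hB.isProbabilityMeasure_publicMeanLaw hF
  have hi := hB.integrable_publicMeanLaw hF
  set U := searchValue δ (publicMeanLaw F ξ B) with hUdef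
  obtain ⟨V, hV⟩ : ∃ V, V = searchValue δ F - U := ⟨_, rfl⟩
  have hU : U = δ * U + ∫ z, max ((∫ θ, θ ∂(B z)) - δ * U) 0 ∂(signalLaw F ξ) := by
    rw [← hB.expectedExcess_publicMeanLaw hF]
    exact (isSearchValue_iff hi).1 (searchValue_spec hδ0 hδ1 _ hi)
  have hF' := (isSearchValue_iff hF).1 (searchValue_spec hδ0 hδ1 F hF)
  have hsum : δ * searchValue δ F = δ * U + δ * V := by rw [hV]; ring
  have hw : 0 ≤ δ * V :=
    mul_nonneg hδ0.le (hV ▸ sub_nonneg.2 (hB.searchValue_publicMeanLaw_le hF hδ0 hδ1))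
  choose G hG hmax hiff using fun z =>
    exists_optimal_contraction (hB.carried z) (hatom z) (δ * U) hw
  have hval : (fun z => persuasionValue (δ * U) (δ * V) (G z)) =ᵐ[signalLaw F ξ]
      fun z => δ * V + expectedExcess (B z) (δ * U + δ * V) := by
    filter_upwards [hgap] with z hz
    rw [hiff, ← hsum]
    exact hz
  have hvi : Integrable (fun z => persuasionValue (δ * U) (δ * V) (G z)) (signalLaw F ξ) :=
    ((integrable_const _).add (hB.integrable_expectedExcess hF _)).congr hval.symm
  have hagent : ∀ z, δ * U + incrementalBenefit θhi (G z) (δ * U) -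
      (expectedExcess (G z) (δ * U) - max ((∫ θ, θ ∂(B z)) - δ * U) 0) =
        δ * U + max ((∫ θ, θ ∂(B z)) - δ * U) 0 := fun z => by
    have := (hG z).1
    rw [incrementalBenefit_eq (hG z).2.1]
    ring
  refine ⟨U, V, fun z => expectedExcess (G z) (δ * U) - max ((∫ θ, θ ∂(B z)) - δ * U) 0, G,
    ⟨fun z => ?_, hG, fun z => ?_, fun z p' _ G' hG' hacc => ?_, ?_, ?_, ?_, ?_⟩, hV⟩
  · exact sub_nonneg.2 (autarky_le_of_mem_contractions (hB.carried z) (hG z) _)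
  · exact (accepts_iff (hB.carried z) (hG z)).2 le_rfl
  · rw [accepts_iff (hB.carried z) hG'] at hacc
    have := hmax z G' hG'
    rw [profit_eq_persuasionValue_sub, profit]
    rw [persuasionValue] at this
    linarith
  · simp_rw [hagent]
    exact (integrable_const _).add (hB.integrable_autarky hF _)
  · simp_rw [hagent]
    rw [integral_add (integrable_const _) (hB.integrable_autarky hF _)]
    simpa using hU
  · simp_rw [profit_eq_persuasionValue_sub]
    exact hvi.sub (hB.integrable_autarky hF _)
  · simp_rw [profit_eq_persuasionValue_sub]
    rw [integral_sub hvi (hB.integrable_autarky hF _), integral_congr_ae hval,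
      hB.integral_const_add_expectedExcess hF, ← hsum]
    linarith

end Equilibria

/-! ### The truncated mean -/

/-- The truncated mean is at most `r` exactly if the partial expectation of `θ - r` is nonpositive;
full support rules out the junk value of a truncation to a null event. -/
theorem truncated_mean_le_iff {a b : ℝ} (hab : a ≤ b) {H : Measure ℝ} [IsProbabilityMeasure H]
    (hid : Integrable (fun m : ℝ => m) H) (hsupp : H.support = Icc a b) {r t : ℝ} (hat : a < t) :
    ∫ θ, θ ∂(H[|Iic t]) ≤ r ↔ gapBelow H r t ≤ 0 := by
  have ha : a ∈ H.support := hsupp ▸ left_mem_Icc.2 hab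
  have hpos : 0 < H.real (Iic t) :=
    ENNReal.toReal_pos ((Measure.mem_support_iff_forall a).1 ha _ (Iic_mem_nhds hat)).ne'
      (measure_ne_top _ _)
  rw [ProbabilityTheory.cond, integral_smul_measure, ENNReal.toReal_inv, ← measureReal_def,
    smul_eq_mul, inv_mul_le_iff₀ hpos, gapBelow_eq hid, sub_nonpos]

end PersuadedSearch

theorem corollary2 {Z : Type*} [MeasurableSpace Z]
    (θlo θhi δ : ℝ) (hθ : θlo < θhi) (hθhi : 0 < θhi) (hδ0 : 0 < δ) (hδ1 : δ < 1)
    (F : Measure ℝ) [IsProbabilityMeasure F] (hFΘ : F (Icc θlo θhi)ᶜ = 0) (hFac : F ≪ volume)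
    (hsearch : θlo < δ * ∫ θ, θ ∂F)
    (ξ : Kernel ℝ Z) [IsMarkovKernel ξ]
    (B : Kernel Z ℝ) (hB : PersuadedSearch.IsInterimBelief θlo θhi F ξ B)
    (hatomless : ∀ z x, B z {x} = 0)
    (hfull : ∀ᵐ z ∂(PersuadedSearch.signalLaw F ξ), (B z).support = Icc θlo θhi) :
    ((∃ (U V : ℝ) (p : Z → ℝ) (G : Z → Measure ℝ),
        PersuadedSearch.IsStationaryEquilibrium θlo θhi δ F ξ B U V p G ∧
        PersuadedSearch.ExtractsEfficientSurplus δ F (PersuadedSearch.publicMeanLaw F ξ B) V) ↔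
      ∀ᵐ z ∂(PersuadedSearch.signalLaw F ξ),
        ∫ θ, θ ∂((B z)[|Iic (PersuadedSearch.reservationValue δ F)]) ≤
          PersuadedSearch.reservationValue δ (PersuadedSearch.publicMeanLaw F ξ B)) ∧
    (((∃ (U V : ℝ) (p : Z → ℝ) (G : Z → Measure ℝ),
        PersuadedSearch.IsStationaryEquilibrium θlo θhi δ F ξ B U V p G) ∧
      ∀ (U V : ℝ) (p : Z → ℝ) (G : Z → Measure ℝ),
        PersuadedSearch.IsStationaryEquilibrium θlo θhi δ F ξ B U V p G →
        PersuadedSearch.ExtractsEfficientSurplus δ F (PersuadedSearch.publicMeanLaw F ξ B) V) ↔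
      ∀ᵐ z ∂(PersuadedSearch.signalLaw F ξ),
        ∫ θ, θ ∂((B z)[|Iic (PersuadedSearch.reservationValue δ F)]) ≤
          PersuadedSearch.reservationValue δ (PersuadedSearch.publicMeanLaw F ξ B)) := by
  have hF := PersuadedSearch.integrable_id_of_carried hFΘ
  have := hB.isMarkovKernel
  have hlo : θlo < PersuadedSearch.reservationValue δ F :=
    hsearch.trans_le
      (mul_le_mul_of_nonneg_left (PersuadedSearch.mean_le_searchValue hδ0 hδ1 hF) hδ0.le)
  have hcond : (∀ᵐ z ∂(PersuadedSearch.signalLaw F ξ),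
      ∫ θ, θ ∂((B z)[|Iic (PersuadedSearch.reservationValue δ F)]) ≤
        PersuadedSearch.reservationValue δ (PersuadedSearch.publicMeanLaw F ξ B)) ↔
      ∀ᵐ z ∂(PersuadedSearch.signalLaw F ξ), PersuadedSearch.gapBelow (B z)
        (PersuadedSearch.reservationValue δ (PersuadedSearch.publicMeanLaw F ξ B))
        (PersuadedSearch.reservationValue δ F) ≤ 0 :=
    Filter.eventually_congr (hfull.mono fun z hz =>
      PersuadedSearch.truncated_mean_le_iff hθ.le
        (PersuadedSearch.integrable_id_of_carried (hB.carried z)) hz hlo)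
  rw [hcond]
  have hextract : ∀ (U V : ℝ) (p : Z → ℝ) (G : Z → Measure ℝ),
      PersuadedSearch.IsStationaryEquilibrium θlo θhi δ F ξ B U V p G →
      (PersuadedSearch.ExtractsEfficientSurplus δ F (PersuadedSearch.publicMeanLaw F ξ B) V ↔
        U + V = PersuadedSearch.searchValue δ F) := by
    intro U V p G h
    rw [PersuadedSearch.ExtractsEfficientSurplus, ← h.agent_value_eq hB hF hδ0 hδ1,
      eq_sub_iff_add_eq']
  have hnec : ∀ (U V : ℝ) (p : Z → ℝ) (G : Z → Measure ℝ),
      PersuadedSearch.IsStationaryEquilibrium θlo θhi δ F ξ B U V p G →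
      PersuadedSearch.ExtractsEfficientSurplus δ F (PersuadedSearch.publicMeanLaw F ξ B) V →
      ∀ᵐ z ∂(PersuadedSearch.signalLaw F ξ), PersuadedSearch.gapBelow (B z)
        (PersuadedSearch.reservationValue δ (PersuadedSearch.publicMeanLaw F ξ B))
        (PersuadedSearch.reservationValue δ F) ≤ 0 := by
    intro U V p G h hex
    have htot := (hextract U V p G h).1 hex
    have := (h.total_value_eq_iff hB hF hatomless hδ0 hδ1).1 htot
    rwa [htot, h.agent_value_eq hB hF hδ0 hδ1] at this
  have hsuff := PersuadedSearch.exists_isStationaryEquilibrium hB hF hatomless hδ0 hδ1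
  refine ⟨⟨fun ⟨U, V, p, G, h, hex⟩ => hnec U V p G h hex, hsuff⟩,
    ⟨fun ⟨⟨U, V, p, G, h⟩, hall⟩ => hnec U V p G h (hall U V p G h), fun hgap => ⟨?_, ?_⟩⟩⟩
  · obtain ⟨U, V, p, G, h, -⟩ := hsuff hgap
    exact ⟨U, V, p, G, h⟩
  · intro U V p G h
    rw [hextract U V p G h, h.total_value_eq_iff hB hF hatomless hδ0 hδ1]
    -- The cutoff `δ (U + V)` of any equilibrium is at most the efficient one, and lowering the
    -- cutoff preserves the condition.
    have hle := mul_le_mul_of_nonneg_left (h.total_value_le hB hF hδ0 hδ1) hδ0.le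
    have hge : δ * U ≤ δ * (U + V) :=
      mul_le_mul_of_nonneg_left
        (le_add_of_nonneg_right (h.principal_value_nonneg hδ0 hδ1)) hδ0.le
    filter_upwards [hgap] with z hz
    rw [PersuadedSearch.reservationValue, ← h.agent_value_eq hB hF hδ0 hδ1] at hz
    exact (PersuadedSearch.gapBelow_mono
      (PersuadedSearch.integrable_id_of_carried (hB.carried z)) hge hle).trans hz
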